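/- Let $R>0$, let $D_0[R]=\{\sigma\in\mathbb{C} : |\sigma|\le R\}$, let $m$ be a positive integer, and let $b=(b_1,\dots,b_m)$ be a row vector of functions $b_i:D_0[R]\to\mathbb{C}$ that are real-analytic, i.e. each $b_i$ extends to a function on an open neighborhood of $D_0[R]$ in $\mathbb{C}=\mathbb{R}^2$ whose real and imaginary parts are real-analytic. Then the linear ensemble system $$\dot x(t,\sigma)=\sigma\,x(t,\sigma)+b(\sigma)u(t),\qquad \sigma\in D_0[R],$$ with states $x(t,\sigma)\in\mathbb{C}$ and a control input $u(t)\in\mathbb{C}^m$ common to all $\sigma$, is not $\mathrm{L}^2$-controllable. Here the system is called $\mathrm{L}^2$-controllable if for every initial profile $x_0\in \mathrm{L}^2(D_0[R],\mathbb{C})$, every target profile $\hat x\in \mathrm{L}^2(D_0[R],\mathbb{C})$ and every $\epsilon>0$ there are a time $T>0$ and an integrable control input $u:[0,T]\to\mathbb{C}^m$ such that the solution with $x(0,\cdot)=x_0$ satisfies $\|x(T,\cdot)-\hat x\|_{\mathrm{L}^2(D_0[R])}<\epsilon$ (Lebesgue measure on $D_0[R]$). -/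

import Mathlib

/-- A function `f`, considered on a subset `S` of the complex plane `ℂ = ℝ²`, is real-analytic if it
extends to a real-analytic function on an open neighbourhood of `S`. Analyticity is over the field
`ℝ`; it amounts to analyticity of the real and the imaginary part in the two real variables. -/
def IsRealAnalyticOn (S : Set ℂ) (f : ℂ → ℂ) : Prop :=
  ∃ U : Set ℂ, IsOpen U ∧ S ⊆ U ∧ ∃ g : ℂ → ℂ, AnalyticOnNhd ℝ g U ∧ Set.EqOn f g S

/-- `x` is the solution on the time interval `[0, T]` of the scalar complex linear ensemble system
`ẋ(t, σ) = a(σ) x(t, σ) + b(σ) u(t)`, `σ ∈ S`, with initial profile `x₀` and control input `u`.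
Since `u` is only integrable, solutions are meant in the sense of Carathéodory: every trajectory
is continuous and satisfies the integrated equation. -/
def IsEnsembleSolution {m : ℕ} (S : Set ℂ) (a : ℂ → ℂ) (b : ℂ → Fin m → ℂ) (T : ℝ)
    (u : ℝ → Fin m → ℂ) (x₀ : ℂ → ℂ) (x : ℝ → ℂ → ℂ) : Prop :=
  ∀ σ ∈ S, ContinuousOn (fun t => x t σ) (Set.Icc 0 T) ∧
    ∀ t ∈ Set.Icc 0 T,
      x t σ = x₀ σ + ∫ s in (0 : ℝ)..t, (a σ * x s σ + ∑ i, b σ i * u s i)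

/-- The ensemble system `ẋ(t, σ) = a(σ) x(t, σ) + b(σ) u(t)`, `σ ∈ S`, with inputs `u(t) ∈ ℂᵐ`, is
L²-controllable: for all initial and target profiles in `L²(S, ℂ)` and every tolerance `ε > 0`
there are a time `T > 0` and an integrable input `u` on `[0, T]`, common to all `σ`, whose solution
satisfies `‖x(T, ·) - x̂‖_{L²(S)} < ε`. -/
def IsL2Controllable {m : ℕ} (S : Set ℂ) (a : ℂ → ℂ) (b : ℂ → Fin m → ℂ) : Prop :=
  ∀ x₀ xhat : ℂ → ℂ,
    MeasureTheory.MemLp x₀ 2 (MeasureTheory.volume.restrict S) →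
    MeasureTheory.MemLp xhat 2 (MeasureTheory.volume.restrict S) →
    ∀ ε : ℝ, 0 < ε →
      ∃ T : ℝ, 0 < T ∧ ∃ u : ℝ → Fin m → ℂ,
        MeasureTheory.IntegrableOn u (Set.Icc 0 T) MeasureTheory.volume ∧
        ∃ x : ℝ → ℂ → ℂ, IsEnsembleSolution S a b T u x₀ x ∧
          MeasureTheory.eLpNorm (fun σ => x T σ - xhat σ) 2 (MeasureTheory.volume.restrict S) <
            ENNReal.ofReal ε

/-!
Starting from rest, the state at time `T` is `x(T, σ) = ∑ i, b i σ * p i σ` with `p i` entire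
(`IsEnsembleSolution.exists_entire_eq`, `variation_of_constants`). So it suffices to find a nonzero
test function `h` supported in the open disc with `∫ h * b i * p = 0` for all `i` and all entire
`p`: then the target `conj h` is orthogonal in `L²` to everything reachable from rest and stays at
distance at least `‖h‖` from it.

Such an `h` exists for any finite family `b` of smooth functions on any nonempty open set `U`
(`exists_testFunction_annihilating`), by induction on the size of the family. A first function
vanishing on `U` can be dropped. Otherwise shrink `U` so that `b 0` has no zeros on it, let `g`
annihilate the smaller family `∂̄ (b i / b 0)`, `i ≠ 0`, and put `h = ∂̄ g / b 0`. As `∂̄ p = 0`,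
integration by parts gives `∫ h * b i * p = - ∫ g * ∂̄ (b i / b 0) * p`, which vanishes for `i = 0`
because `b 0 / b 0` is constant and for `i ≠ 0` by the choice of `g`; and `h ≠ 0` because a nonzero
function with compact support is not holomorphic. Real-analyticity of `b` is used only through
smoothness.
-/

open MeasureTheory Complex Set
open scoped ContDiff

/-! ### The Cauchy–Riemann operator on test functions -/

/-- The Cauchy–Riemann operator `∂/∂x + i ∂/∂y`, that is, twice the Wirtinger derivative
`∂/∂z̄`. -/
noncomputable def dbar (f : ℂ → ℂ) (z : ℂ) : ℂ :=
  fderiv ℝ f z 1 + I * fderiv ℝ f z I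

lemma dbar_mul {f g : ℂ → ℂ} {z : ℂ} (hf : DifferentiableAt ℝ f z)
    (hg : DifferentiableAt ℝ g z) :
    dbar (fun w => f w * g w) z = f z * dbar g z + dbar f z * g z := by
  simp only [dbar, fderiv_fun_mul hf hg, add_apply,
    smul_apply, smul_eq_mul]
  ring

lemma differentiableAt_iff_dbar_eq_zero {f : ℂ → ℂ} {z : ℂ} (hf : DifferentiableAt ℝ f z) :
    DifferentiableAt ℂ f z ↔ dbar f z = 0 := by
  rw [differentiableAt_complex_iff_differentiableAt_real, dbar, smul_eq_mul]
  constructor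
  · rintro ⟨-, h⟩
    rw [h, ← mul_assoc, I_mul_I]
    ring
  · refine fun h => ⟨hf, ?_⟩
    linear_combination (-I) * h + fderiv ℝ f z I * I_mul_I

lemma Filter.EventuallyEq.dbar_eq {f g : ℂ → ℂ} {z : ℂ} (h : f =ᶠ[nhds z] g) :
    dbar f z = dbar g z := by
  rw [dbar, dbar, h.fderiv_eq]

lemma ContDiffOn.dbar {f : ℂ → ℂ} {U : Set ℂ} (hf : ContDiffOn ℝ ∞ f U) (hU : IsOpen U) :
    ContDiffOn ℝ ∞ (dbar f) U := by
  have h := hf.fderiv_of_isOpen hU (m := ∞) (by simp)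
  exact (h.clm_apply contDiffOn_const).add
    (contDiffOn_const.mul (h.clm_apply contDiffOn_const))

lemma tsupport_dbar_subset (f : ℂ → ℂ) : tsupport (dbar f) ⊆ tsupport f := by
  refine closure_minimal (fun z hz => ?_) (isClosed_tsupport f)
  by_contra hzf
  refine hz ?_
  have h : f =ᶠ[nhds z] fun _ => 0 := notMem_tsupport_iff_eventuallyEq.1 hzf
  simp [dbar, h.fderiv_eq]

lemma contDiff_mul_of_tsupport_subset {g q : ℂ → ℂ} {U : Set ℂ} (hU : IsOpen U)
    (hg : ContDiffOn ℝ ∞ g U) (hgU : tsupport g ⊆ U) (hq : ContDiffOn ℝ ∞ q U) :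
    ContDiff ℝ ∞ (fun z => g z * q z) := by
  refine contDiff_iff_contDiffAt.2 fun z => ?_
  by_cases hz : z ∈ tsupport g
  · exact (hg.mul hq).contDiffAt (hU.mem_nhds (hgU hz))
  · refine (contDiffAt_const (c := (0 : ℂ))).congr_of_eventuallyEq ?_
    filter_upwards [notMem_tsupport_iff_eventuallyEq.1 hz] with w hw
    simp [hw]

lemma integrable_mul_of_tsupport_subset {g q : ℂ → ℂ} {U : Set ℂ} (hU : IsOpen U)
    (hg : ContDiffOn ℝ ∞ g U) (hgc : HasCompactSupport g) (hgU : tsupport g ⊆ U)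
    (hq : ContDiffOn ℝ ∞ q U) : Integrable (fun z => g z * q z) :=
  (contDiff_mul_of_tsupport_subset hU hg hgU hq).continuous.integrable_of_hasCompactSupport
    hgc.mul_right

lemma integral_dbar_mul {g q : ℂ → ℂ} {U : Set ℂ} (hU : IsOpen U) (hg : ContDiff ℝ ∞ g)
    (hgc : HasCompactSupport g) (hgU : tsupport g ⊆ U) (hq : ContDiffOn ℝ ∞ q U) :
    ∫ z, dbar g z * q z = -∫ z, g z * dbar q z := by
  have hdq (v : ℂ) : ContDiffOn ℝ ∞ (fun z => fderiv ℝ q z v) U :=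
    (hq.fderiv_of_isOpen hU (m := ∞) (by simp)).clm_apply contDiffOn_const
  have hdg (v : ℂ) : ContDiff ℝ ∞ (fun z => fderiv ℝ g z v) :=
    (hg.fderiv_right (m := ∞) (by simp)).clm_apply contDiff_const
  have hl (v : ℂ) : Integrable (fun z => fderiv ℝ g z v * q z) :=
    integrable_mul_of_tsupport_subset hU (hdg v).contDiffOn (hgc.fderiv_apply ℝ v)
      ((tsupport_fderiv_apply_subset ℝ v).trans hgU) hq
  have hr (v : ℂ) : Integrable (fun z => g z * fderiv ℝ q z v) :=
    integrable_mul_of_tsupport_subset hU hg.contDiffOn hgc hgU (hdq v)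
  have key (v : ℂ) : ∫ z, g z * fderiv ℝ q z v = -∫ z, fderiv ℝ g z v * q z :=
    integral_smul_fderiv_eq_neg_fderiv_smul_of_integrable (hl v) (hr v)
      (integrable_mul_of_tsupport_subset hU hg.contDiffOn hgc hgU hq)
      (fun z _ => hg.differentiable (by simp) z)
      (fun z hz => (hq.contDiffAt (hU.mem_nhds (hgU hz))).differentiableAt (by simp))
  have e1 : ∫ z, dbar g z * q z
      = (∫ z, fderiv ℝ g z 1 * q z) + I * ∫ z, fderiv ℝ g z I * q z := by
    rw [← integral_const_mul, ← integral_add (hl 1) ((hl I).const_mul I)]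
    exact integral_congr_ae (.of_forall fun z => by simp only [dbar]; ring)
  have e2 : ∫ z, g z * dbar q z
      = (∫ z, g z * fderiv ℝ q z 1) + I * ∫ z, g z * fderiv ℝ q z I := by
    rw [← integral_const_mul, ← integral_add (hr 1) ((hr I).const_mul I)]
    exact integral_congr_ae (.of_forall fun z => by simp only [dbar]; ring)
  rw [e1, e2, key, key]
  ring

/-- A holomorphic function with compact support is zero, by Liouville's theorem. -/
lemma exists_dbar_ne_zero {g : ℂ → ℂ} (hg : ContDiff ℝ ∞ g) (hgc : HasCompactSupport g)
    (hg0 : g ≠ 0) : ∃ z, dbar g z ≠ 0 := by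
  by_contra! h
  have hd : Differentiable ℂ g := fun z =>
    (differentiableAt_iff_dbar_eq_zero (hg.differentiable (by simp) z)).2 (h z)
  exact hg0 (hd.eq_const_of_tendsto_cocompact hgc.is_zero_at_infty)

/-! ### Annihilators of finitely generated modules over the entire functions -/

/-- The module generated over the entire functions by finitely many smooth functions on a nonempty
open set `U` is annihilated by a nonzero test function on `U`. -/
theorem exists_testFunction_annihilating (m : ℕ) :
    ∀ (U : Set ℂ) (b : Fin m → ℂ → ℂ), IsOpen U → U.Nonempty →
      (∀ i, ContDiffOn ℝ ∞ (b i) U) →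
      ∃ h : ℂ → ℂ, ContDiff ℝ ∞ h ∧ HasCompactSupport h ∧ tsupport h ⊆ U ∧ h ≠ 0 ∧
        ∀ i, ∀ p : ℂ → ℂ, Differentiable ℂ p → ∫ z, h z * (b i z * p z) = 0 := by
  induction m with
  | zero =>
    rintro U - hU ⟨c, hc⟩ -
    obtain ⟨f, hfU, hfc, hf, -, hf1⟩ :=
      exists_contDiff_tsupport_subset (n := ⊤) (hU.mem_nhds hc)
    refine ⟨fun z => (f z : ℂ), ofRealCLM.contDiff.comp hf, hfc.comp_left ofReal_zero,
      (tsupport_comp_subset ofReal_zero f).trans hfU, fun h => ?_, fun i => i.elim0⟩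
    simpa [hf1] using congrFun h c
  | succ m ih =>
    intro U b hU hne hb
    by_cases h0 : ∀ z ∈ U, b 0 z = 0
    · obtain ⟨h, hs, hc, hsub, hnz, hann⟩ := ih U (fun i => b i.succ) hU hne fun i => hb _
      refine ⟨h, hs, hc, hsub, hnz, Fin.cases (fun p _ => ?_) hann⟩
      refine integral_eq_zero_of_ae (.of_forall fun z => ?_)
      by_cases hz : z ∈ tsupport h
      · simp [h0 z (hsub hz)]
      · simp [image_eq_zero_of_notMem_tsupport hz]
    · push Not at h0
      obtain ⟨c, hcU, hc0⟩ := h0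
      set V : Set ℂ := U ∩ b 0 ⁻¹' {0}ᶜ
      have hVo : IsOpen V := (hb 0).continuousOn.isOpen_inter_preimage hU isOpen_compl_singleton
      have hbV (i) : ContDiffOn ℝ ∞ (b i) V := (hb i).mono inter_subset_left
      have hnz0 : ∀ z ∈ V, b 0 z ≠ 0 := fun z hz => hz.2
      have hq (i) : ContDiffOn ℝ ∞ (fun z => b i z / b 0 z) V := by
        simp only [div_eq_mul_inv]
        exact (hbV i).mul ((hbV 0).inv hnz0)
      obtain ⟨g, hg, hgc, hgV, hg0, hann⟩ :=
        ih V (fun i => dbar fun z => b i.succ z / b 0 z) hVo ⟨c, hcU, hc0⟩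
          fun i => (hq _).dbar hVo
      have hdg : ContDiff ℝ ∞ (dbar g) :=
        contDiffOn_univ.1 (hg.contDiffOn.dbar isOpen_univ)
      have hdgV : tsupport (dbar g) ⊆ V := (tsupport_dbar_subset g).trans hgV
      have hdgc : HasCompactSupport (dbar g) :=
        hgc.of_isClosed_subset (isClosed_tsupport _) (tsupport_dbar_subset g)
      refine ⟨fun z => dbar g z * (b 0 z)⁻¹,
        contDiff_mul_of_tsupport_subset hVo hdg.contDiffOn hdgV ((hbV 0).inv hnz0),
        hdgc.mul_right, tsupport_mul_subset_left.trans (hdgV.trans inter_subset_left), ?_, ?_⟩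
      · obtain ⟨z, hz⟩ := exists_dbar_ne_zero hg hgc hg0
        exact fun h => mul_ne_zero hz
          (inv_ne_zero (hnz0 z (hdgV (subset_tsupport _ hz)))) (congrFun h z)
      · intro i p hp
        have hpR : ContDiff ℝ ∞ p := hp.contDiff.restrict_scalars ℝ
        have e1 : ∫ z, dbar g z * (b 0 z)⁻¹ * (b i z * p z)
            = -∫ z, g z * (dbar (fun z => b i z / b 0 z) z * p z) := by
          have e2 := integral_dbar_mul hVo hg hgc hgV ((hq i).mul hpR.contDiffOn)
          calc _ = ∫ z, dbar g z * (b i z / b 0 z * p z) :=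
                integral_congr_ae (.of_forall fun z => by simp only [div_eq_mul_inv]; ring)
            _ = -∫ z, g z * dbar (fun z => b i z / b 0 z * p z) z := e2
            _ = _ := by
              congr 1
              refine integral_congr_ae (.of_forall fun z => ?_)
              by_cases hz : z ∈ tsupport g
              · have hd := ((hq i).contDiffAt (hVo.mem_nhds (hgV hz))).differentiableAt
                  (by simp)
                have hpz := hpR.differentiable (by simp) z
                simp [dbar_mul hd hpz, (differentiableAt_iff_dbar_eq_zero hpz).1 (hp z)]
              · simp [image_eq_zero_of_notMem_tsupport hz]
        rw [e1, neg_eq_zero]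
        revert i
        refine Fin.cases ?_ fun i _ => hann i p hp
        intro _
        refine integral_eq_zero_of_ae (.of_forall fun z => ?_)
        by_cases hz : z ∈ tsupport g
        · have hone : (fun z => b 0 z / b 0 z) =ᶠ[nhds z] fun _ => 1 := by
            filter_upwards [hVo.mem_nhds (hgV hz)] with w hw using div_self (hnz0 w hw)
          simp only [hone.dbar_eq]
          simp [dbar]
        · simp [image_eq_zero_of_notMem_tsupport hz]

/-! ### States reachable from rest -/

/-- The variation of constants formula at the final time, integrated by parts so that only the
primitive of the merely integrable input `v` enters. -/
lemma variation_of_constants {T : ℝ} (hT : 0 ≤ T) {c : ℂ} {v x : ℝ → ℂ}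
    (hv : IntegrableOn v (Icc 0 T)) (hx : ContinuousOn x (Icc 0 T))
    (h : ∀ t ∈ Icc 0 T, x t = ∫ s in (0 : ℝ)..t, (c * x s + v s)) :
    x T = (∫ s in (0 : ℝ)..T, v s)
      + c * ∫ s in (0 : ℝ)..T, exp (c * (T - s : ℝ)) * ∫ r in (0 : ℝ)..s, v r := by
  have hvi : ∀ t ∈ Icc 0 T, IntervalIntegrable v volume 0 t := fun t ht =>
    (intervalIntegrable_iff_integrableOn_Icc_of_le ht.1).2
      (hv.mono_set (Icc_subset_Icc_right ht.2))
  have hxi : ∀ t ∈ Icc 0 T, IntervalIntegrable x volume 0 t := fun t ht =>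
    (hx.mono (Icc_subset_Icc_right ht.2)).intervalIntegrable_of_Icc ht.1
  have hsplit : ∀ t ∈ Icc 0 T,
      x t = c * (∫ s in (0 : ℝ)..t, x s) + ∫ s in (0 : ℝ)..t, v s := fun t ht => by
    rw [h t ht, intervalIntegral.integral_add ((hxi t ht).const_mul c) (hvi t ht),
      intervalIntegral.integral_const_mul]
  have hTT : T ∈ Icc 0 T := right_mem_Icc.2 hT
  have hXc : ContinuousOn (fun t => ∫ s in (0 : ℝ)..t, x s) (Icc 0 T) :=
    intervalIntegral.continuousOn_primitive_interval
      (by rw [uIcc_of_le hT]; exact hx.integrableOn_Icc) |>.mono (by rw [uIcc_of_le hT])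
  have hYc : ContinuousOn (fun t => ∫ s in (0 : ℝ)..t, v s) (Icc 0 T) :=
    intervalIntegral.continuousOn_primitive_interval
      (by rwa [uIcc_of_le hT]) |>.mono (by rw [uIcc_of_le hT])
  have hEc : Continuous fun t : ℝ => exp (c * (T - t : ℝ)) := by fun_prop
  have hE (t : ℝ) : HasDerivAt (fun t : ℝ => exp (c * (T - t : ℝ)))
      (exp (c * (T - t : ℝ)) * (-c)) t := by
    have h1 : HasDerivAt (fun t : ℝ => c * ((T - t : ℝ) : ℂ)) (c * ((-1 : ℝ) : ℂ)) t :=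
      (((hasDerivAt_id t).const_sub T).ofReal_comp).const_mul c
    simpa using h1.cexp
  have ftc := intervalIntegral.integral_eq_sub_of_hasDerivAt_of_le hT
    (f := fun t => exp (c * (T - t : ℝ)) * ∫ s in (0 : ℝ)..t, x s)
    (f' := fun t => exp (c * (T - t : ℝ)) * ∫ s in (0 : ℝ)..t, v s)
    (hEc.continuousOn.mul hXc) (fun t ht => by
      have htI := Ioo_subset_Icc_self ht
      have hX : HasDerivAt (fun t => ∫ s in (0 : ℝ)..t, x s) (x t) t :=
        intervalIntegral.integral_hasDerivAt_right (hxi t htI)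
          (hx.mono Ioo_subset_Icc_self |>.stronglyMeasurableAtFilter isOpen_Ioo t ht)
          (hx.continuousAt (Icc_mem_nhds ht.1 ht.2))
      refine ((hE t).mul hX).congr_deriv ?_
      rw [hsplit t htI]
      ring)
    ((hEc.continuousOn.mul hYc).intervalIntegrable_of_Icc hT)
  rw [ftc, hsplit T hTT]
  simp
  ring

lemma differentiable_integral_exp_mul {T : ℝ} (hT : 0 ≤ T) {Y : ℝ → ℂ}
    (hY : ContinuousOn Y (Icc 0 T)) :
    Differentiable ℂ fun c : ℂ => ∫ s in (0 : ℝ)..T, exp (c * (T - s : ℝ)) * Y s := by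
  intro c₀
  have hF (c : ℂ) : ContinuousOn (fun s : ℝ => exp (c * (T - s : ℝ)) * Y s) (Icc 0 T) :=
    (by fun_prop : Continuous fun s : ℝ => exp (c * (T - s : ℝ))).continuousOn.mul hY
  have hF' : ContinuousOn
      (fun s : ℝ => exp (c₀ * (T - s : ℝ)) * ((T - s : ℝ) : ℂ) * Y s) (Icc 0 T) :=
    (by fun_prop : Continuous
      fun s : ℝ => exp (c₀ * (T - s : ℝ)) * ((T - s : ℝ) : ℂ)).continuousOn.mul hY
  have hB : ContinuousOn
      (fun s : ℝ => Real.exp ((‖c₀‖ + 1) * |T - s|) * |T - s| * ‖Y s‖) (Icc 0 T) :=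
    (by fun_prop : Continuous
      fun s : ℝ => Real.exp ((‖c₀‖ + 1) * |T - s|) * |T - s|).continuousOn.mul hY.norm
  have meas {f : ℝ → ℂ} (hf : ContinuousOn f (Icc 0 T)) :
      AEStronglyMeasurable f (volume.restrict (uIoc 0 T)) := by
    rw [uIoc_of_le hT]
    exact (hf.mono Ioc_subset_Icc_self).aestronglyMeasurable measurableSet_Ioc
  refine (intervalIntegral.hasDerivAt_integral_of_dominated_loc_of_deriv_le
    (F' := fun c s => exp (c * (T - s : ℝ)) * ((T - s : ℝ) : ℂ) * Y s)
    (Metric.ball_mem_nhds c₀ one_pos) (.of_forall fun c => meas (hF c))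
    ((hF c₀).intervalIntegrable_of_Icc hT) (meas hF') (.of_forall fun s _ c hc => ?_)
    (hB.intervalIntegrable_of_Icc hT) (.of_forall fun s _ c _ => ?_)).2.differentiableAt
  · have hc' : ‖c‖ ≤ ‖c₀‖ + 1 := by
      have := norm_le_norm_add_norm_sub' c c₀
      have := mem_ball_iff_norm.1 hc
      linarith
    rw [norm_mul, norm_mul, norm_real, Real.norm_eq_abs]
    gcongr
    refine (norm_exp_le_exp_norm _).trans (Real.exp_le_exp.2 ?_)
    rw [norm_mul, norm_real, Real.norm_eq_abs]
    gcongr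
  · have h1 : HasDerivAt (fun c : ℂ => c * ((T - s : ℝ) : ℂ)) ((T - s : ℝ) : ℂ) c := by
      simpa using (hasDerivAt_id c).mul_const ((T - s : ℝ) : ℂ)
    exact h1.cexp.mul_const _

/-- Every state of the ensemble `ẋ = σ x + b(σ) u` reachable from rest lies in the module generated
by the `b i` over the entire functions. -/
lemma IsEnsembleSolution.exists_entire_eq {m : ℕ} {S : Set ℂ} {b : ℂ → Fin m → ℂ} {T : ℝ}
    (hT : 0 ≤ T) {u : ℝ → Fin m → ℂ} (hu : IntegrableOn u (Icc 0 T)) {x : ℝ → ℂ → ℂ}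
    (hx : IsEnsembleSolution S (fun σ => σ) b T u (fun _ => 0) x) :
    ∃ p : Fin m → ℂ → ℂ, (∀ i, Differentiable ℂ (p i)) ∧
      ∀ σ ∈ S, x T σ = ∑ i, b σ i * p i σ := by
  have hui (i) : IntegrableOn (fun s => u s i) (Icc 0 T) := hu.eval i
  have hYc (i) : ContinuousOn (fun t => ∫ s in (0 : ℝ)..t, u s i) (Icc 0 T) :=
    intervalIntegral.continuousOn_primitive_interval
      (by rw [uIcc_of_le hT]; exact hui i) |>.mono (by rw [uIcc_of_le hT])
  refine ⟨fun i σ => (∫ s in (0 : ℝ)..T, u s i)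
    + σ * ∫ s in (0 : ℝ)..T, exp (σ * (T - s : ℝ)) * ∫ r in (0 : ℝ)..s, u r i,
    fun i => (differentiable_const _).add
      (differentiable_id.mul (differentiable_integral_exp_mul hT (hYc i))), fun σ hσ => ?_⟩
  obtain ⟨hxc, hxe⟩ := hx σ hσ
  have hv : IntegrableOn (fun s => ∑ i, b σ i * u s i) (Icc 0 T) :=
    integrable_finsetSum _ fun i _ => (hui i).const_mul _
  have hsum : ∀ t ∈ Icc 0 T, ∫ s in (0 : ℝ)..t, ∑ i, b σ i * u s i
      = ∑ i, b σ i * ∫ s in (0 : ℝ)..t, u s i := fun t ht => by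
    rw [intervalIntegral.integral_finsetSum fun i _ => ?_]
    · simp only [intervalIntegral.integral_const_mul]
    · exact ((intervalIntegrable_iff_integrableOn_Icc_of_le ht.1).2
        ((hui i).mono_set (Icc_subset_Icc_right ht.2))).const_mul _
  rw [variation_of_constants hT hv hxc fun t ht => by simpa using hxe t ht,
    hsum T (right_mem_Icc.2 hT)]
  have hint : ∫ s in (0 : ℝ)..T, exp (σ * (T - s : ℝ)) * ∫ r in (0 : ℝ)..s, ∑ i, b σ i * u r i
      = ∑ i, b σ i * ∫ s in (0 : ℝ)..T, exp (σ * (T - s : ℝ)) * ∫ r in (0 : ℝ)..s, u r i := by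
    have hci (i) : IntervalIntegrable (fun s : ℝ => b σ i * (exp (σ * (T - s : ℝ))
        * ∫ r in (0 : ℝ)..s, u r i)) volume 0 T :=
      (((by fun_prop : Continuous fun s : ℝ => exp (σ * (T - s : ℝ))).continuousOn.mul
        (hYc i)).intervalIntegrable_of_Icc hT).const_mul _
    calc _ = ∫ s in (0 : ℝ)..T, ∑ i, b σ i * (exp (σ * (T - s : ℝ))
            * ∫ r in (0 : ℝ)..s, u r i) :=
          intervalIntegral.integral_congr fun s hs => by
            rw [uIcc_of_le hT] at hs
            simp only [hsum s hs, Finset.mul_sum]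
            exact Finset.sum_congr rfl fun i _ => by ring
      _ = _ := by
          rw [intervalIntegral.integral_finsetSum fun i _ => hci i]
          exact Finset.sum_congr rfl fun i _ => intervalIntegral.integral_const_mul _ _
  rw [hint, Finset.mul_sum, ← Finset.sum_add_distrib]
  exact Finset.sum_congr rfl fun i _ => by ring

/-! ### Uncontrollability -/

/-- In `L²`, the distance of `conj h` to a function orthogonal to it is at least `‖h‖`. -/
lemma eLpNorm_le_eLpNorm_sub_conj {μ : Measure ℂ} {h f : ℂ → ℂ} (hh : MemLp h 2 μ)
    (hf : MemLp f 2 μ) (h0 : ∫ z, h z * f z ∂μ = 0) :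
    eLpNorm h 2 μ ≤ eLpNorm (fun z => f z - (starRingEnd ℂ) (h z)) 2 μ := by
  have hc : MemLp (fun z => (starRingEnd ℂ) (h z)) 2 μ := hh.star
  have hnorm : eLpNorm h 2 μ = eLpNorm (fun z => (starRingEnd ℂ) (h z)) 2 μ :=
    eLpNorm_congr_norm_ae (.of_forall fun z => by simp)
  have hin : inner ℂ (hc.toLp _) (hf.toLp f) = 0 := by
    rw [L2.inner_def, ← h0]
    refine integral_congr_ae ?_
    filter_upwards [hc.coeFn_toLp, hf.coeFn_toLp] with z h1 h2
    simp [h1, h2, mul_comm]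
  have hle : ‖hc.toLp _‖ ≤ ‖hf.toLp f - hc.toLp _‖ := by
    have h3 := norm_sub_sq (𝕜 := ℂ) (hf.toLp f) (hc.toLp _)
    rw [inner_eq_zero_symm.1 hin] at h3
    refine le_of_sq_le_sq ?_ (norm_nonneg _)
    rw [h3]
    simp
  rw [← MemLp.toLp_sub, Lp.norm_toLp, Lp.norm_toLp] at hle
  rw [hnorm]
  exact (ENNReal.toReal_le_toReal hc.eLpNorm_ne_top (hf.sub hc).eLpNorm_ne_top).1 hle

theorem theorem2 (R : ℝ) (hR : 0 < R) (m : ℕ) (b : ℂ → Fin m → ℂ)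
    (hb : ∀ i : Fin m, IsRealAnalyticOn (Metric.closedBall (0 : ℂ) R) (fun σ => b σ i)) :
    ¬ IsL2Controllable (Metric.closedBall (0 : ℂ) R) (fun σ => σ) b := by
  intro hctrl
  set D := Metric.closedBall (0 : ℂ) R
  have hbc (i) : ContinuousOn (fun σ => b σ i) D := by
    obtain ⟨U, -, hDU, g, hg, heq⟩ := hb i
    exact (hg.continuousOn.mono hDU).congr heq
  have hbs (i) : ContDiffOn ℝ ∞ (fun σ => b σ i) (Metric.ball 0 R) := by
    obtain ⟨U, -, hDU, g, hg, heq⟩ := hb i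
    exact ((hg.mono (Metric.ball_subset_closedBall.trans hDU)).contDiffOn
      Metric.isOpen_ball.uniqueDiffOn).congr (heq.mono Metric.ball_subset_closedBall)
  obtain ⟨h, hs, hc, hsub, hne, hann⟩ := exists_testFunction_annihilating m (Metric.ball 0 R)
    (fun i σ => b σ i) Metric.isOpen_ball ⟨0, Metric.mem_ball_self hR⟩ hbs
  have hzero : ∀ z ∉ D, h z = 0 := fun z hz =>
    image_eq_zero_of_notMem_tsupport fun hz' => hz (Metric.ball_subset_closedBall (hsub hz'))
  have hmem : MemLp h 2 volume := hs.continuous.memLp_of_hasCompactSupport hc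
  have hmemD : MemLp h 2 (volume.restrict D) := hmem.restrict D
  have hpos : eLpNorm h 2 (volume.restrict D) ≠ 0 := by
    rw [← eLpNorm_indicator_eq_eLpNorm_restrict Metric.isClosed_closedBall.measurableSet,
      indicator_eq_self.2 fun z hz => by_contra fun hz' => hz (hzero z hz'),
      Ne, eLpNorm_eq_zero_iff hmem.1 two_ne_zero]
    exact fun h0 => hne ((hs.continuous.ae_eq_iff_eq volume continuous_zero).1 h0)
  obtain ⟨T, hT, u, hu, x, hx, hlt⟩ := hctrl (fun _ => 0) (fun z => (starRingEnd ℂ) (h z))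
    MemLp.zero' hmemD.star _ (ENNReal.toReal_pos hpos hmemD.eLpNorm_ne_top)
  rw [ENNReal.ofReal_toReal hmemD.eLpNorm_ne_top] at hlt
  obtain ⟨p, hp, hxp⟩ := hx.exists_entire_eq hT.le hu
  have hcont (i) : ContinuousOn (fun σ => b σ i * p i σ) D :=
    (hbc i).mul (hp i).continuous.continuousOn
  have hxc : ContinuousOn (x T) D :=
    (continuousOn_finsetSum _ fun i _ => hcont i).congr hxp
  have hxm : MemLp (x T) 2 (volume.restrict D) := by
    obtain ⟨C, hC⟩ := (isCompact_closedBall (0 : ℂ) R).exists_bound_of_continuousOn hxc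
    have : IsFiniteMeasure (volume.restrict D) :=
      isFiniteMeasure_restrict.2 measure_closedBall_lt_top.ne
    exact .of_bound (hxc.aestronglyMeasurable Metric.isClosed_closedBall.measurableSet) C
      ((ae_restrict_iff' Metric.isClosed_closedBall.measurableSet).2 (.of_forall hC))
  have horth : ∫ z in D, h z * x T z = 0 := by
    calc ∫ z in D, h z * x T z = ∫ z in D, ∑ i, h z * (b z i * p i z) :=
          setIntegral_congr_fun Metric.isClosed_closedBall.measurableSet fun z hz => by
            simp only [hxp z hz, Finset.mul_sum]
      _ = ∑ i, ∫ z in D, h z * (b z i * p i z) := integral_finsetSum _ fun i _ =>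
          (hs.continuous.continuousOn.mul (hcont i)).integrableOn_compact
            (isCompact_closedBall 0 R)
      _ = 0 := Finset.sum_eq_zero fun i _ => by
          rw [setIntegral_eq_integral_of_forall_compl_eq_zero fun z hz => by
            rw [hzero z hz, zero_mul]]
          exact hann i _ (hp i)
  exact hlt.not_ge (eLpNorm_le_eLpNorm_sub_conj hmemD hxm horth)
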